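/- Write points of $T^*\mathbb R^3$ as $(x,y,z,p_x,p_y,p_z)$. A Kepler–Heisenberg orbit is a solution, defined for all times and never meeting $(x,y,z)=(0,0,0)$, of Hamilton's equations for $$H=\tfrac12\Big(\big(p_x-\tfrac12 y p_z\big)^2+\big(p_y+\tfrac12 x p_z\big)^2\Big)-\frac{1}{8\pi\sqrt{(x^2+y^2)^2+16z^2}} .$$ A periodic orbit with least period $T$ in phase space has rotation number $j/k$ (in lowest terms) if $T/k$ is the least positive time after which the orbit repeats itself up to a rotation about the $z$-axis (acting on positions and momenta), and in every time interval of length $T/k$ the point $(x,y,z)$ turns by exactly $2\pi j/k$ counterclockwise about the $z$-axis. Here the turning is measured by a polar angle of $(x,y)$ that is continuous in time as long as $(x,y)\neq(0,0)$; each time the orbit passes through the $z$-axis this angle jumps by half a turn, and the jump is counted as $+\pi$. Theorem. For all coprime positive integers $j\le k$ (that is, for every rational $j/k\in(0,1]$, written in lowest terms) there is a periodic Kepler–Heisenberg orbit with rotation number $j/k$. If $j<k$, the orbit can be chosen to avoid the $z$-axis, so that its polar angle is continuous at all times and, after every $k$-th part of the period, has grown by exactly $2\pi j/k$. -/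

import Mathlib

open Filter Topology

namespace KeplerHeisenberg

/-- The Kepler-Heisenberg Hamiltonian on `T*ℝ³`, with `q = (x, y, z)` and `p = (p_x, p_y, p_z)`:
kinetic energy `(P_X² + P_Y²) / 2` plus potential `-1 / (8π √((x² + y²)² + 16 z²))`. -/
noncomputable def hamiltonian (q p : Fin 3 → ℝ) : ℝ :=
  ((p 0 - q 1 * p 2 / 2) ^ 2 + (p 1 + q 0 * p 2 / 2) ^ 2) / 2
    - 1 / (8 * Real.pi * Real.sqrt ((q 0 ^ 2 + q 1 ^ 2) ^ 2 + 16 * q 2 ^ 2))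

/-- The partial derivative `∂H/∂qᵢ`. -/
noncomputable def partialQ (i : Fin 3) (q p : Fin 3 → ℝ) : ℝ :=
  deriv (fun v : ℝ => hamiltonian (Function.update q i v) p) (q i)

/-- The partial derivative `∂H/∂pᵢ`. -/
noncomputable def partialP (i : Fin 3) (q p : Fin 3 → ℝ) : ℝ :=
  deriv (fun v : ℝ => hamiltonian q (Function.update p i v)) (p i)

/-- A Kepler-Heisenberg orbit defined for all times: a curve `(q, p)` in phase space that never
meets the singularity of the potential (the sun, at the origin) and solves Hamilton's equations. -/
structure IsOrbit (q p : ℝ → Fin 3 → ℝ) : Prop where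
  ne_zero : ∀ t, q t ≠ 0
  deriv_q : ∀ t i, HasDerivAt (fun s => q s i) (partialP i (q t) (p t)) t
  deriv_p : ∀ t i, HasDerivAt (fun s => p s i) (-partialQ i (q t) (p t)) t

/-- The point lies on the `z`-axis. -/
def OnAxis (v : Fin 3 → ℝ) : Prop := v 0 = 0 ∧ v 1 = 0

/-- Counterclockwise rotation by the angle `α` about the `z`-axis. -/
noncomputable def rotZ (α : ℝ) (v : Fin 3 → ℝ) : Fin 3 → ℝ :=
  ![Real.cos α * v 0 - Real.sin α * v 1, Real.sin α * v 0 + Real.cos α * v 1, v 2]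

/-- `T` is the period (the least positive one) of the phase curve `(q, p)`. -/
def IsMinimalPeriod (q p : ℝ → Fin 3 → ℝ) (T : ℝ) : Prop :=
  IsLeast {τ : ℝ | 0 < τ ∧ ∀ t, q (t + τ) = q t ∧ p (t + τ) = p t} T

/-- `τ` is the least positive time after which the phase curve `(q, p)` repeats itself up to a
rotation about the `z`-axis (which acts on positions and on momenta). -/
def IsMinimalRelativePeriod (q p : ℝ → Fin 3 → ℝ) (τ : ℝ) : Prop :=
  IsLeast {τ : ℝ | 0 < τ ∧ ∃ α : ℝ, ∀ t, q (t + τ) = rotZ α (q t) ∧ p (t + τ) = rotZ α (p t)} τ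

/-- `θ` is a total turning angle about the `z`-axis along the space curve `q`: a polar angle of
`(x, y)` that is continuous as long as the curve is off the `z`-axis. When the projection of the
curve to the `xy`-plane passes through the origin, its polar angle jumps by a half turn; the jump is
counted as a counterclockwise half turn, `+π`. For a curve that avoids the `z`-axis, this is just a
continuous choice of the polar angle. -/
structure IsTurningAngle (q : ℝ → Fin 3 → ℝ) (θ : ℝ → ℝ) : Prop where
  polar : ∀ t, q t 0 = Real.sqrt (q t 0 ^ 2 + q t 1 ^ 2) * Real.cos (θ t) ∧
    q t 1 = Real.sqrt (q t 0 ^ 2 + q t 1 ^ 2) * Real.sin (θ t)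
  continuousAt : ∀ t, ¬ OnAxis (q t) → ContinuousAt θ t
  half_turn : ∀ t, OnAxis (q t) →
    ∃ l : ℝ, Tendsto θ (𝓝[<] t) (𝓝 l) ∧ Tendsto θ (𝓝[>] t) (𝓝 (l + Real.pi))

/-- The phase curve `(q, p)` of period `T` has the rotation number `j / k` (a fraction in lowest
terms): one `k`-th of the period is the least time after which the curve repeats itself up to a
rotation about the `z`-axis, and in every time interval of this length the total turning angle
about the `z`-axis grows by exactly `2π · j / k`. -/
def HasRotationNumber (q p : ℝ → Fin 3 → ℝ) (T : ℝ) (j k : ℕ) : Prop :=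
  IsMinimalRelativePeriod q p (T / k) ∧
    ∃ θ : ℝ → ℝ, IsTurningAngle q θ ∧ ∀ t, θ (t + T / k) = θ t + 2 * Real.pi * (j / k)

end KeplerHeisenberg

namespace KeplerHeisenberg

/-! The orbits are sought where the energy and the dilational momentum both vanish. In signed polar
coordinates scaled by the homogeneous norm `ρ`, with `R = r/ρ` and `s = 4z/ρ²` on the curve `R⁴ + s²
= 1`, the shape then evolves independently of `ρ` and of the polar angle, once time is rescaled by
`ρ²`. `IsReducedSolutionAt` records this system, and `hasDerivAt_position` and `hasDerivAt_momentum`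
lift it back to Hamilton's equations.

For nonzero angular momentum the shape equation is solved explicitly by a trigonometric
substitution, with one parameter `e`, the least value of `R`. The norm has a closed form in the
shape and is therefore periodic too, so each solution closes up after `2π` up to a rotation. The
angle of that rotation is the integral of `swing`. It depends continuously on `e` and runs from `2π`
at `e = 0` to `0` at `e = 1`, so by the intermediate value theorem it equals `2πj/k` for some `e`
strictly between, whenever `j < k` (`exists_param_integral_swing_eq`). There `R > 0`, and the orbit
avoids the axis.

For `j = k = 1` the solution without angular momentum serves: its whole turn comes from two passages
through the axis.

Minimality of the periods holds because `s` attains its value at one chosen parameter only once per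
loop, and because `k` and `j` are coprime (`exists_orbit_of_loop`). -/

/-! ### Partial derivatives of the Hamiltonian -/

theorem partialP_zero (q p : Fin 3 → ℝ) : partialP 0 q p = p 0 - q 1 * p 2 / 2 := by
  have h : HasDerivAt (fun v : ℝ => hamiltonian q (Function.update p 0 v))
      (p 0 - q 1 * p 2 / 2) (p 0) := by
    simp only [hamiltonian, Function.update_self, ne_eq, Fin.reduceEq, not_false_eq_true,
      Function.update_of_ne]
    refine HasDerivAt.congr_deriv (((((hasDerivAt_id (p 0)).sub_const (q 1 * p 2 / 2)).pow 2).add_const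
      ((p 1 + q 0 * p 2 / 2) ^ 2) |>.div_const 2).sub_const _) ?_
    simp
  exact h.deriv

theorem partialP_one (q p : Fin 3 → ℝ) : partialP 1 q p = p 1 + q 0 * p 2 / 2 := by
  have h : HasDerivAt (fun v : ℝ => hamiltonian q (Function.update p 1 v))
      (p 1 + q 0 * p 2 / 2) (p 1) := by
    simp only [hamiltonian, Function.update_self, ne_eq, Fin.reduceEq, not_false_eq_true,
      Function.update_of_ne]
    refine HasDerivAt.congr_deriv (((((hasDerivAt_id (p 1)).add_const (q 0 * p 2 / 2)).pow 2).const_add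
      ((p 0 - q 1 * p 2 / 2) ^ 2) |>.div_const 2).sub_const _) ?_
    simp
  exact h.deriv

theorem partialP_two (q p : Fin 3 → ℝ) : partialP 2 q p =
    (q 0 * (p 1 + q 0 * p 2 / 2) - q 1 * (p 0 - q 1 * p 2 / 2)) / 2 := by
  have h : HasDerivAt (fun v : ℝ => hamiltonian q (Function.update p 2 v))
      ((q 0 * (p 1 + q 0 * p 2 / 2) - q 1 * (p 0 - q 1 * p 2 / 2)) / 2) (p 2) := by
    simp only [hamiltonian, Function.update_self, ne_eq, Fin.reduceEq, not_false_eq_true,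
      Function.update_of_ne]
    have h1 := (((hasDerivAt_id (p 2)).const_mul (q 1)).div_const 2).const_sub (p 0)
    have h2 := (((hasDerivAt_id (p 2)).const_mul (q 0)).div_const 2).const_add (p 1)
    refine HasDerivAt.congr_deriv ((((h1.pow 2).add (h2.pow 2)).div_const 2).sub_const _) ?_
    simp
    ring
  exact h.deriv

/-- The derivative of the potential along a curve on which the fourth power of the homogeneous
norm has derivative `N'`. -/
theorem hasDerivAt_potential {N : ℝ → ℝ} {N' D v : ℝ} (hD : 0 < D) (hN : N v = D ^ 2)
    (h : HasDerivAt N N' v) :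
    HasDerivAt (fun v => 1 / (8 * Real.pi * Real.sqrt (N v))) (-N' / (16 * Real.pi * D ^ 3)) v := by
  have hs : Real.sqrt (N v) = D := by rw [hN, Real.sqrt_sq hD.le]
  have h1 := (h.sqrt (by rw [hN]; positivity)).const_mul (8 * Real.pi)
  have h2 := h1.inv (by rw [hs]; positivity)
  simp only [one_div]
  refine HasDerivAt.congr_deriv (h2) ?_
  rw [hs]
  field_simp
  ring

theorem partialQ_zero {q : Fin 3 → ℝ} (p : Fin 3 → ℝ) {D : ℝ} (hD : 0 < D)
    (hN : (q 0 ^ 2 + q 1 ^ 2) ^ 2 + 16 * q 2 ^ 2 = D ^ 2) :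
    partialQ 0 q p = (p 1 + q 0 * p 2 / 2) * p 2 / 2
      + q 0 * (q 0 ^ 2 + q 1 ^ 2) / (4 * Real.pi * D ^ 3) := by
  apply HasDerivAt.deriv
  simp only [hamiltonian, Function.update_self, ne_eq, Fin.reduceEq, not_false_eq_true,
      Function.update_of_ne]
  have h0 := hasDerivAt_id (q 0)
  have h1 := (((h0.mul_const (p 2)).div_const 2).const_add (p 1)).pow 2
  have h2 := ((((h0.pow 2).add_const (q 1 ^ 2)).pow 2).add_const (16 * q 2 ^ 2))
  have h3 := hasDerivAt_potential hD (v := q 0) (by simpa using hN) h2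
  refine HasDerivAt.congr_deriv (((h1.const_add ((p 0 - q 1 * p 2 / 2) ^ 2)).div_const 2).sub h3) ?_
  simp
  field_simp
  ring

theorem partialQ_one {q : Fin 3 → ℝ} (p : Fin 3 → ℝ) {D : ℝ} (hD : 0 < D)
    (hN : (q 0 ^ 2 + q 1 ^ 2) ^ 2 + 16 * q 2 ^ 2 = D ^ 2) :
    partialQ 1 q p = -((p 0 - q 1 * p 2 / 2) * p 2 / 2)
      + q 1 * (q 0 ^ 2 + q 1 ^ 2) / (4 * Real.pi * D ^ 3) := by
  apply HasDerivAt.deriv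
  simp only [hamiltonian, Function.update_self, ne_eq, Fin.reduceEq, not_false_eq_true,
      Function.update_of_ne]
  have h0 := hasDerivAt_id (q 1)
  have h1 := (((h0.mul_const (p 2)).div_const 2).const_sub (p 0)).pow 2
  have h2 := ((((h0.pow 2).const_add (q 0 ^ 2)).pow 2).add_const (16 * q 2 ^ 2))
  have h3 := hasDerivAt_potential hD (v := q 1) (by simpa using hN) h2
  refine HasDerivAt.congr_deriv (((h1.add_const ((p 1 + q 0 * p 2 / 2) ^ 2)).div_const 2).sub h3) ?_
  simp
  field_simp
  ring

theorem partialQ_two {q : Fin 3 → ℝ} (p : Fin 3 → ℝ) {D : ℝ} (hD : 0 < D)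
    (hN : (q 0 ^ 2 + q 1 ^ 2) ^ 2 + 16 * q 2 ^ 2 = D ^ 2) :
    partialQ 2 q p = 2 * q 2 / (Real.pi * D ^ 3) := by
  apply HasDerivAt.deriv
  simp only [hamiltonian, Function.update_self, ne_eq, Fin.reduceEq, not_false_eq_true,
      Function.update_of_ne]
  have h0 := hasDerivAt_id (q 2)
  have h2 := ((h0.pow 2).const_mul 16).const_add ((q 0 ^ 2 + q 1 ^ 2) ^ 2)
  have h3 := hasDerivAt_potential hD (v := q 2) (by simpa using hN) h2
  refine HasDerivAt.congr_deriv (h3.const_sub (((p 0 - q 1 * p 2 / 2) ^ 2 + (p 1 + q 0 * p 2 / 2) ^ 2) / 2)) ?_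
  simp
  field_simp

/-! ### Reduction at zero energy and zero dilational momentum -/

/-- The position with homogeneous norm `ρ`, signed polar coordinates `ρ R` and `θ` in the plane,
and height `ρ² s / 4`. -/
noncomputable def polarPosition (ρ R s θ : ℝ) : Fin 3 → ℝ :=
  ![ρ * R * Real.cos θ, ρ * R * Real.sin θ, ρ ^ 2 * s / 4]

/-- The momentum of zero energy and zero dilational momentum, with angular momentum `L`,
radial velocity governed by `h` and `l = L / R`. -/
noncomputable def polarMomentum (L ρ R s h l θ : ℝ) : Fin 3 → ℝ :=
  ![(s * (L * R - h / 2) * Real.cos θ - l * Real.sin θ) / ρ,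
    (s * (L * R - h / 2) * Real.sin θ + l * Real.cos θ) / ρ,
    (R * h - 2 * L * R ^ 2) / ρ ^ 2]

/-- The reduced equations of motion on the zero level of the energy and of the dilational momentum,
for a curve with the time parameter whose rate is `u ρ²`. -/
structure IsReducedSolutionAt (L : ℝ) (ρ R s h l θ : ℝ → ℝ) (k u χ : ℝ) : Prop where
  ρ_pos : 0 < ρ χ
  l_eq : l χ = k * R χ
  L_eq : L = k * R χ ^ 2
  norm_eq : R χ ^ 4 + s χ ^ 2 = 1
  energy : h χ ^ 2 = 1 / Real.pi - 4 * l χ ^ 2 * s χ ^ 2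
  deriv_R : HasDerivAt R (u * (-s χ * h χ / 2)) χ
  deriv_s : HasDerivAt s (u * (R χ ^ 3 * h χ)) χ
  deriv_h : HasDerivAt h (u * (-2 * k ^ 2 * R χ * s χ * (1 + R χ ^ 4))) χ
  deriv_l : HasDerivAt l (u * (k * s χ * h χ / 2)) χ
  deriv_ρ : HasDerivAt ρ (u * (L * s χ * ρ χ)) χ
  deriv_θ : HasDerivAt θ (u * (R χ * h χ / 2 + k * s χ ^ 2)) χ

theorem polarPosition_norm {ρ R s θ : ℝ} (h : R ^ 4 + s ^ 2 = 1) :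
    ((polarPosition ρ R s θ) 0 ^ 2 + (polarPosition ρ R s θ) 1 ^ 2) ^ 2
      + 16 * (polarPosition ρ R s θ) 2 ^ 2 = (ρ ^ 2) ^ 2 := by
  simp only [polarPosition, Matrix.cons_val]
  have := Real.sin_sq_add_cos_sq θ
  linear_combination (ρ ^ 4) * h
    + ρ ^ 4 * R ^ 4 * (Real.sin θ ^ 2 + Real.cos θ ^ 2 + 1) * this

theorem polarPosition_radius (ρ R s θ : ℝ) :
    (polarPosition ρ R s θ) 0 ^ 2 + (polarPosition ρ R s θ) 1 ^ 2 = ρ ^ 2 * R ^ 2 := by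
  simp only [polarPosition, Matrix.cons_val]
  linear_combination ρ ^ 2 * R ^ 2 * Real.sin_sq_add_cos_sq θ

/-- Only `ρ` is ever divided by. The number `k` plays the part of `L/R²`, so the computation stays
valid on the axis, where `R = 0`. -/
theorem IsReducedSolutionAt.hasDerivAt_position {L : ℝ} {ρ R s h l θ : ℝ → ℝ} {k u χ : ℝ}
    (H : IsReducedSolutionAt L ρ R s h l θ k u χ) (i : Fin 3) :
    HasDerivAt (fun χ => polarPosition (ρ χ) (R χ) (s χ) (θ χ) i)
      (u * ρ χ ^ 2 * partialP i (polarPosition (ρ χ) (R χ) (s χ) (θ χ))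
        (polarMomentum L (ρ χ) (R χ) (s χ) (h χ) (l χ) (θ χ))) χ := by
  obtain ⟨hρ, hl, hL, hn, he, dR, ds, dh, dl, dρ, dθ⟩ := H
  have hp := Real.sin_sq_add_cos_sq (θ χ)
  fin_cases i
  · simp only [Fin.zero_eta, partialP_zero]
    simp only [polarPosition, polarMomentum, Matrix.cons_val]
    refine HasDerivAt.congr_deriv ((dρ.mul dR).mul dθ.cos) ?_
    simp only [Pi.mul_apply]
    rw [hl, hL]
    field_simp
    generalize Real.sin (θ χ) = S, Real.cos (θ χ) = C at *
    grind
  · simp only [Fin.mk_one, partialP_one]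
    simp only [polarPosition, polarMomentum, Matrix.cons_val]
    refine HasDerivAt.congr_deriv ((dρ.mul dR).mul dθ.sin) ?_
    simp only [Pi.mul_apply]
    rw [hl, hL]
    field_simp
    generalize Real.sin (θ χ) = S, Real.cos (θ χ) = C at *
    grind
  · simp only [Fin.reduceFinMk, partialP_two]
    simp only [polarPosition, polarMomentum, Matrix.cons_val]
    refine HasDerivAt.congr_deriv (((dρ.pow 2).mul ds).div_const 4) ?_
    simp only [Pi.pow_apply]
    rw [hl, hL]
    field_simp
    simp only [Nat.cast_ofNat]
    generalize Real.sin (θ χ) = S, Real.cos (θ χ) = C at *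
    grind

theorem IsReducedSolutionAt.hasDerivAt_momentum {L : ℝ} {ρ R s h l θ : ℝ → ℝ} {k u χ : ℝ}
    (H : IsReducedSolutionAt L ρ R s h l θ k u χ) (i : Fin 3) :
    HasDerivAt (fun χ => polarMomentum L (ρ χ) (R χ) (s χ) (h χ) (l χ) (θ χ) i)
      (u * ρ χ ^ 2 * -partialQ i (polarPosition (ρ χ) (R χ) (s χ) (θ χ))
        (polarMomentum L (ρ χ) (R χ) (s χ) (h χ) (l χ) (θ χ))) χ := by
  obtain ⟨hρ, hl, hL, hn, he, dR, ds, dh, dl, dρ, dθ⟩ := H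
  have hp := Real.sin_sq_add_cos_sq (θ χ)
  have hD : 0 < ρ χ ^ 2 := by positivity
  have hN := polarPosition_norm (ρ := ρ χ) (θ := θ χ) hn
  have hr := polarPosition_radius (ρ χ) (R χ) (s χ) (θ χ)
  rw [hl] at he
  have he' : Real.pi * h χ ^ 2 = 1 - Real.pi * (4 * (k * R χ) ^ 2 * s χ ^ 2) := by
    rw [he]
    field_simp
  clear he
  -- The product `s (L R - h/2)` is `ρ` times the radial momentum, which enters both horizontal
  -- components.
  have dν := ds.mul ((dR.const_mul L).sub (dh.div_const 2))
  fin_cases i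
  · simp only [Fin.zero_eta, partialQ_zero _ hD hN, hr]
    simp only [polarPosition, polarMomentum, Matrix.cons_val]
    refine HasDerivAt.congr_deriv (((dν.mul dθ.cos).sub (dl.mul dθ.sin)).div dρ hρ.ne') ?_
    simp only [Pi.mul_apply, Pi.sub_apply]
    rw [hl, hL]
    field_simp
    generalize Real.sin (θ χ) = S, Real.cos (θ χ) = C at *
    clear dν dR ds dh dl dρ dθ hN hr hl hD
    grind
  · simp only [Fin.mk_one, partialQ_one _ hD hN, hr]
    simp only [polarPosition, polarMomentum, Matrix.cons_val]
    refine HasDerivAt.congr_deriv (((dν.mul dθ.sin).add (dl.mul dθ.cos)).div dρ hρ.ne') ?_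
    simp only [Pi.mul_apply, Pi.sub_apply, Pi.add_apply]
    rw [hl, hL]
    field_simp
    generalize Real.sin (θ χ) = S, Real.cos (θ χ) = C at *
    clear dν dR ds dh dl dρ dθ hN hr hl hD
    grind
  · simp only [Fin.reduceFinMk, partialQ_two _ hD hN]
    simp only [polarPosition, polarMomentum, Matrix.cons_val]
    refine HasDerivAt.congr_deriv (((dR.mul dh).sub ((dR.pow 2).const_mul (2 * L))).div (dρ.pow 2) (by positivity)) ?_
    simp only [Pi.mul_apply, Pi.sub_apply, Pi.pow_apply]
    rw [hL]
    field_simp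
    simp only [Nat.cast_ofNat]
    clear dν dR ds dh dl dρ dθ hN hr hl hD
    grind

/-! ### From closed loops up to rotation to periodic orbits -/

/-- A periodic positive rate of time can be integrated and inverted: the parameter `σ` becomes a
function of time. -/
theorem exists_timeChange {W : ℝ → ℝ} {a : ℝ} (ha : 0 < a) (hc : Continuous W) (hpos : ∀ χ, 0 < W χ)
    (hper : Function.Periodic W a) :
    ∃ (σ : ℝ → ℝ) (T : ℝ), 0 < T ∧ StrictMono σ ∧ Continuous σ ∧ Function.Surjective σ ∧
      (∀ t, HasDerivAt σ (W (σ t))⁻¹ t) ∧ ∀ t, σ (t + T) = σ t + a := by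
  set F : ℝ → ℝ := fun χ => ∫ x in (0 : ℝ)..χ, W x with hF
  have hint : ∀ b c, IntervalIntegrable W MeasureTheory.volume b c := fun b c =>
    hc.intervalIntegrable b c
  have hd : ∀ χ, HasDerivAt F (W χ) χ := fun χ =>
    intervalIntegral.integral_hasDerivAt_right (hint 0 χ) (hc.stronglyMeasurableAtFilter _ _)
      hc.continuousAt
  have hmono : StrictMono F := strictMono_of_hasDerivAt_pos hd hpos
  have hFc : Continuous F := continuous_iff_continuousAt.2 fun χ => (hd χ).continuousAt
  -- The integral over each period is the same positive number, so elapsed time is unbounded in both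
  -- directions and every time is reached.
  have htop : Tendsto F atTop atTop :=
    hper.tendsto_atTop_intervalIntegral_of_pos' (hint 0 a) hpos ha
  have hbot : Tendsto F atBot atBot :=
    hper.tendsto_atBot_intervalIntegral_of_pos' (hint 0 a) hpos ha
  have hsurj : Function.Surjective F := hFc.surjective htop hbot
  set e : ℝ ≃o ℝ := hmono.orderIsoOfSurjective F hsurj with he
  have hFe : ∀ t, F (e.symm t) = t := fun t => e.apply_symm_apply t
  have heF : ∀ χ, e.symm (F χ) = χ := fun χ => e.symm_apply_apply χ
  refine ⟨e.symm, F a, ?_, e.symm.strictMono, e.symm.continuous, e.symm.surjective, fun t => ?_,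
    fun t => ?_⟩
  · have := hmono ha
    simpa [hF] using this
  · exact HasDerivAt.of_local_left_inverse e.symm.continuous.continuousAt (hd _) (hpos _).ne'
      (Eventually.of_forall hFe)
  · apply hmono.injective
    rw [hFe]
    have h1 : F (e.symm t + a) = F (e.symm t) + ∫ x in (e.symm t)..(e.symm t + a), W x := by
      simp only [hF]
      rw [intervalIntegral.integral_add_adjacent_intervals (hint _ _) (hint _ _)]
    rw [h1, hFe, hper.intervalIntegral_add_eq (e.symm t) 0]
    simp [hF]

theorem rotZ_zero_sq_add_one_sq (α : ℝ) (v : Fin 3 → ℝ) :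
    rotZ α v 0 ^ 2 + rotZ α v 1 ^ 2 = v 0 ^ 2 + v 1 ^ 2 := by
  simp only [rotZ, Matrix.cons_val]
  linear_combination (v 0 ^ 2 + v 1 ^ 2) * Real.sin_sq_add_cos_sq α

theorem rotZ_two (α : ℝ) (v : Fin 3 → ℝ) : rotZ α v 2 = v 2 := rfl

theorem rotZ_rotZ (α β : ℝ) (v : Fin 3 → ℝ) : rotZ α (rotZ β v) = rotZ (β + α) v := by
  funext i
  fin_cases i <;> simp only [rotZ, Fin.zero_eta, Fin.mk_one, Fin.reduceFinMk, Matrix.cons_val,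
    Real.cos_add, Real.sin_add] <;> ring

theorem rotZ_zero (v : Fin 3 → ℝ) : rotZ 0 v = v := by
  funext i
  fin_cases i <;> simp [rotZ]

theorem rotZ_two_pi_mul_nat (n : ℕ) (v : Fin 3 → ℝ) : rotZ (n * (2 * Real.pi)) v = v := by
  have hs : Real.sin (n * (2 * Real.pi)) = 0 := by simpa using Real.sin_add_nat_mul_two_pi 0 n
  funext i
  fin_cases i <;> simp [rotZ, Real.cos_nat_mul_two_pi, hs]

/-- Pairing the horizontal part of `rotZ α v = v` with that of `v` leaves `(cos α - 1)(x² + y²) =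
0`. -/
theorem cos_eq_one_of_rotZ_eq {α : ℝ} {v : Fin 3 → ℝ} (hv : ¬ OnAxis v) (h : rotZ α v = v) :
    Real.cos α = 1 := by
  have h0 := congrFun h 0
  have h1 := congrFun h 1
  simp only [rotZ, Matrix.cons_val] at h0 h1
  have h2 : (Real.cos α - 1) * (v 0 ^ 2 + v 1 ^ 2) = 0 := by
    linear_combination v 0 * h0 + v 1 * h1
  rcases mul_eq_zero.1 h2 with h3 | h3
  · linarith
  · exact absurd ⟨by nlinarith [sq_nonneg (v 0), sq_nonneg (v 1)],
      by nlinarith [sq_nonneg (v 0), sq_nonneg (v 1)]⟩ hv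

theorem add_nat_mul_eq_rotZ {Q : ℝ → Fin 3 → ℝ} {a α : ℝ} (h : ∀ χ, Q (χ + a) = rotZ α (Q χ))
    (n : ℕ) (χ : ℝ) : Q (χ + n * a) = rotZ (n * α) (Q χ) := by
  induction n with
  | zero => simp [rotZ_zero]
  | succ n ih =>
    have : χ + ((n + 1 : ℕ) : ℝ) * a = (χ + n * a) + a := by push_cast; ring
    rw [this, h, ih, rotZ_rotZ]
    congr 1
    push_cast
    ring

/-- An increasing time change maps left and right neighbourhoods to left and right ones, so a half
turn keeps its sign. -/
theorem IsTurningAngle.comp {Q : ℝ → Fin 3 → ℝ} {Θ σ : ℝ → ℝ} (h : IsTurningAngle Q Θ)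
    (hmono : StrictMono σ) (hc : Continuous σ) :
    IsTurningAngle (fun t => Q (σ t)) (fun t => Θ (σ t)) := by
  refine ⟨fun t => h.polar _, fun t ht => (h.continuousAt _ ht).comp hc.continuousAt,
    fun t ht => ?_⟩
  obtain ⟨l, h1, h2⟩ := h.half_turn _ ht
  refine ⟨l, h1.comp ?_, h2.comp ?_⟩
  · exact tendsto_nhdsWithin_iff.2 ⟨hc.continuousAt.tendsto.mono_left nhdsWithin_le_nhds,
      eventually_nhdsWithin_of_forall fun s hs => hmono hs⟩
  · exact tendsto_nhdsWithin_iff.2 ⟨hc.continuousAt.tendsto.mono_left nhdsWithin_le_nhds,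
      eventually_nhdsWithin_of_forall fun s hs => hmono hs⟩

/-- A curve that solves Hamilton's equations up to a change of the time parameter, and that returns
after the parameter `2π` up to the rotation by `2π j / k`, yields a periodic orbit with rotation
number `j / k`. -/
theorem exists_orbit_of_loop {Q P : ℝ → Fin 3 → ℝ} {W Θ : ℝ → ℝ} {j k : ℕ} {χ₀ χ₁ : ℝ}
    (hk : 0 < k) (hcop : Nat.Coprime j k) (hWc : Continuous W) (hW : ∀ χ, 0 < W χ)
    (hWper : Function.Periodic W (2 * Real.pi))
    (dQ : ∀ χ i, HasDerivAt (fun χ => Q χ i) (W χ * partialP i (Q χ) (P χ)) χ)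
    (dP : ∀ χ i, HasDerivAt (fun χ => P χ i) (W χ * -partialQ i (Q χ) (P χ)) χ)
    (hne : ∀ χ, Q χ ≠ 0)
    (hQ : ∀ χ, Q (χ + 2 * Real.pi) = rotZ (2 * Real.pi * (j / k)) (Q χ))
    (hP : ∀ χ, P (χ + 2 * Real.pi) = rotZ (2 * Real.pi * (j / k)) (P χ))
    (hax : ¬ OnAxis (Q χ₁))
    (hdist : ∀ χ, Q χ 2 = Q χ₀ 2 → Q χ 0 ^ 2 + Q χ 1 ^ 2 = Q χ₀ 0 ^ 2 + Q χ₀ 1 ^ 2 →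
      ∃ n : ℤ, χ = χ₀ + n * (2 * Real.pi))
    (hΘ : IsTurningAngle Q Θ)
    (hΘper : ∀ χ, Θ (χ + 2 * Real.pi) = Θ χ + 2 * Real.pi * (j / k)) :
    ∃ (q p : ℝ → Fin 3 → ℝ) (T : ℝ), IsOrbit q p ∧ IsMinimalPeriod q p T ∧
      HasRotationNumber q p T j k ∧ ∀ t, ∃ χ, q t = Q χ := by
  obtain ⟨σ, T, hT, hmono, hσc, hsurj, hσd, hσT⟩ := exists_timeChange Real.two_pi_pos hWc hW hWper
  have hk0 : (k : ℝ) ≠ 0 := by positivity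
  have hk1 : (0 : ℝ) < k := by positivity
  have hσn : ∀ (n : ℕ) (t : ℝ), σ (t + n * T) = σ t + n * (2 * Real.pi) := by
    intro n t
    induction n with
    | zero => simp
    | succ n ih =>
      have : t + ((n + 1 : ℕ) : ℝ) * T = (t + n * T) + T := by push_cast; ring
      rw [this, hσT, ih]
      push_cast
      ring
  obtain ⟨t₀, ht₀⟩ := hsurj χ₀
  obtain ⟨t₁, ht₁⟩ := hsurj χ₁
  -- Rotations preserve height and distance to the axis, and these two identify the parameter `χ₀`
  -- modulo `2π`. Hence every relative period is a multiple of `T`.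
  have hrel : ∀ τ α : ℝ, 0 < τ → Q (σ (t₀ + τ)) = rotZ α (Q (σ t₀)) →
      ∃ n : ℕ, 0 < n ∧ τ = n * T := by
    intro τ α hτ h
    rw [ht₀] at h
    obtain ⟨n, hn⟩ := hdist (σ (t₀ + τ)) (by rw [h, rotZ_two])
      (by rw [h, rotZ_zero_sq_add_one_sq])
    have h1 : χ₀ < σ (t₀ + τ) := ht₀ ▸ hmono (by linarith)
    have hn0 : 0 < n := by
      have h2 : (0 : ℝ) < n * (2 * Real.pi) := by linarith
      exact_mod_cast pos_of_mul_pos_left h2 Real.two_pi_pos.le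
    lift n to ℕ using hn0.le
    refine ⟨n, by exact_mod_cast hn0, ?_⟩
    have h3 := hσn n t₀
    rw [ht₀] at h3
    have h4 := hmono.injective (hn.trans (by rw [h3, Int.cast_natCast]) : σ (t₀ + τ) = σ (t₀ + n * T))
    linarith
  have hTk : (k * T) / k = T := by field_simp
  refine ⟨fun t => Q (σ t), fun t => P (σ t), k * T, ⟨fun t => hne _, fun t i => ?_, fun t i => ?_⟩,
    ⟨⟨by positivity, fun t => ?_⟩, ?_⟩, ⟨⟨⟨?_, 2 * Real.pi * (j / k), fun t => ?_⟩, ?_⟩,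
      fun t => Θ (σ t), hΘ.comp hmono hσc, fun t => ?_⟩, fun t => ⟨σ t, rfl⟩⟩
  · refine HasDerivAt.congr_deriv ((dQ (σ t) i).comp t (hσd t)) ?_
    have := (hW (σ t)).ne'
    field_simp
  · refine HasDerivAt.congr_deriv ((dP (σ t) i).comp t (hσd t)) ?_
    have := (hW (σ t)).ne'
    field_simp
  · have h : (k : ℝ) * (2 * Real.pi * (j / k)) = j * (2 * Real.pi) := by field_simp
    dsimp only
    rw [hσn, add_nat_mul_eq_rotZ hQ, add_nat_mul_eq_rotZ hP, h, rotZ_two_pi_mul_nat,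
      rotZ_two_pi_mul_nat]
    exact ⟨rfl, rfl⟩
  · rintro τ ⟨hτ, h⟩
    obtain ⟨n, hn, rfl⟩ := hrel τ 0 hτ (by rw [rotZ_zero]; exact (h t₀).1)
    -- The point at `t₀` may lie on the axis, where every rotation fixes it; the rotation angle is
    -- read off at `t₁`, off the axis.
    have h1 := (h t₁).1
    dsimp only at h1
    rw [hσn, add_nat_mul_eq_rotZ hQ] at h1
    obtain ⟨m, hm⟩ := (Real.cos_eq_one_iff _).1 (cos_eq_one_of_rotZ_eq (ht₁ ▸ hax) h1)
    have h2 : (m : ℝ) * k = n * j := by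
      have := Real.pi_pos.ne'
      field_simp at hm
      linarith
    have h3 : m * (k : ℤ) = ((n * j : ℕ) : ℤ) := by
      push_cast
      exact_mod_cast h2
    -- After `n` loops the rotation by `2πnj/k` is trivial only if `k` divides `nj`, hence `n`.
    have h4 : k ∣ n * j := Int.natCast_dvd_natCast.1 ⟨m, by rw [← h3, mul_comm]⟩
    have h5 : k ≤ n := Nat.le_of_dvd hn (hcop.symm.dvd_of_dvd_mul_right h4)
    have h6 : (k : ℝ) ≤ n := by exact_mod_cast h5
    exact mul_le_mul_of_nonneg_right h6 hT.le
  · rwa [hTk]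
  · dsimp only
    rw [hTk, hσT, hQ, hP]
    exact ⟨rfl, rfl⟩
  · rintro τ ⟨hτ, α, h⟩
    obtain ⟨n, hn, rfl⟩ := hrel τ α hτ (h t₀).1
    rw [hTk]
    have : (1 : ℝ) ≤ n := by exact_mod_cast hn
    nlinarith
  · dsimp only
    rw [hTk, hσT, hΘper]

theorem rotZ_polarPosition (α ρ R s θ : ℝ) :
    rotZ α (polarPosition ρ R s θ) = polarPosition ρ R s (θ + α) := by
  funext i
  fin_cases i <;> simp only [rotZ, polarPosition, Fin.zero_eta, Fin.mk_one, Fin.reduceFinMk,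
    Matrix.cons_val, Real.cos_add, Real.sin_add] <;> ring

theorem rotZ_polarMomentum (α L ρ R s h l θ : ℝ) :
    rotZ α (polarMomentum L ρ R s h l θ) = polarMomentum L ρ R s h l (θ + α) := by
  funext i
  fin_cases i <;> simp only [rotZ, polarMomentum, Fin.zero_eta, Fin.mk_one, Fin.reduceFinMk,
    Matrix.cons_val, Real.cos_add, Real.sin_add] <;> ring

theorem not_onAxis_polarPosition {ρ R s θ : ℝ} (hρ : ρ ≠ 0) (hR : R ≠ 0) :
    ¬ OnAxis (polarPosition ρ R s θ) := by
  rintro ⟨h0, h1⟩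
  have h2 := polarPosition_radius ρ R s θ
  rw [h0, h1] at h2
  have h3 : 0 < ρ ^ 2 * R ^ 2 := by positivity
  linarith

/-- A solution of the reduced equations whose shape is `2π`-periodic and whose polar angle grows by
`2π j / k` over a period, up to whole turns, yields a periodic orbit with rotation number `j / k`. -/
theorem exists_orbit_of_reducedSolution {L : ℝ} {ρ R s h l θ k u Θ : ℝ → ℝ} {j n : ℕ} {m : ℤ} {χ₀ χ₁ : ℝ}
    (hn : 0 < n) (hcop : Nat.Coprime j n)
    (H : ∀ χ, IsReducedSolutionAt L ρ R s h l θ (k χ) (u χ) χ)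
    (huc : Continuous u) (hu : ∀ χ, 0 < u χ) (huper : Function.Periodic u (2 * Real.pi))
    (hρ : Function.Periodic ρ (2 * Real.pi)) (hR : Function.Periodic R (2 * Real.pi))
    (hs : Function.Periodic s (2 * Real.pi)) (hh : Function.Periodic h (2 * Real.pi))
    (hl : Function.Periodic l (2 * Real.pi))
    (hθ : ∀ χ, θ (χ + 2 * Real.pi) = θ χ + 2 * Real.pi * (j / n) + m * (2 * Real.pi))
    (hax : R χ₁ ≠ 0) (hdist : ∀ χ, s χ = s χ₀ → ∃ n : ℤ, χ = χ₀ + n * (2 * Real.pi))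
    (hΘ : IsTurningAngle (fun χ => polarPosition (ρ χ) (R χ) (s χ) (θ χ)) Θ)
    (hΘper : ∀ χ, Θ (χ + 2 * Real.pi) = Θ χ + 2 * Real.pi * (j / n)) :
    ∃ (q p : ℝ → Fin 3 → ℝ) (T : ℝ), IsOrbit q p ∧ IsMinimalPeriod q p T ∧
      HasRotationNumber q p T j n ∧
        ∀ t, ∃ χ, q t = polarPosition (ρ χ) (R χ) (s χ) (θ χ) := by
  have hρc : Continuous ρ := continuous_iff_continuousAt.2 fun χ => (H χ).deriv_ρ.continuousAt
  refine exists_orbit_of_loop (W := fun χ => u χ * ρ χ ^ 2)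
    (P := fun χ => polarMomentum L (ρ χ) (R χ) (s χ) (h χ) (l χ) (θ χ)) (χ₀ := χ₀) (χ₁ := χ₁)
    hn hcop (huc.mul (hρc.pow 2)) (fun χ => mul_pos (hu χ) (pow_pos (H χ).ρ_pos 2))
    (fun χ => by simp only [huper χ, hρ χ]) (fun χ i => (H χ).hasDerivAt_position i)
    (fun χ i => (H χ).hasDerivAt_momentum i) (fun χ h0 => ?_) (fun χ => ?_) (fun χ => ?_) ?_
    (fun χ hz hr => ?_) hΘ hΘper
  · have h1 := polarPosition_norm (ρ := ρ χ) (θ := θ χ) (H χ).norm_eq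
    rw [h0] at h1
    have := (H χ).ρ_pos
    simp at h1
    exact (pow_pos (pow_pos this 2) 2).ne' h1.symm
  · rw [rotZ_polarPosition, hρ, hR, hs, hθ]
    simp only [polarPosition, Real.cos_add_int_mul_two_pi, Real.sin_add_int_mul_two_pi]
  · rw [rotZ_polarMomentum, hρ, hR, hs, hh, hl, hθ]
    simp only [polarMomentum, Real.cos_add_int_mul_two_pi, Real.sin_add_int_mul_two_pi]
  · exact not_onAxis_polarPosition (H χ₁).ρ_pos.ne' hax
  -- Height and distance to the axis determine `ρ`, and then the height determines `s`.
  · have h1 := polarPosition_norm (ρ := ρ χ) (θ := θ χ) (H χ).norm_eq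
    rw [hz, hr, polarPosition_norm (H χ₀).norm_eq] at h1
    have h2 : ρ χ ^ 2 = ρ χ₀ ^ 2 :=
      ((pow_left_inj₀ (by positivity) (by positivity) two_ne_zero).1 h1).symm
    have h3 : ρ χ ^ 2 * s χ / 4 = ρ χ₀ ^ 2 * s χ₀ / 4 := hz
    rw [h2] at h3
    have h4 := pow_pos (H χ₀).ρ_pos 2
    exact hdist χ (mul_left_cancel₀ h4.ne' (by linarith))

/-! ### The orbit through the axis -/

theorem exists_int_of_sin_eq_one {χ : ℝ} (h : Real.sin χ = 1) :
    ∃ n : ℤ, χ = Real.pi / 2 + n * (2 * Real.pi) := by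
  rw [← Real.cos_pi_div_two_sub, Real.cos_eq_one_iff] at h
  obtain ⟨n, hn⟩ := h
  exact ⟨-n, by push_cast; linarith⟩

/-- The angle that grows by `π` whenever the cosine changes sign turns the cosine into its absolute
value. -/
theorem abs_cos_eq_negOnePow_floor (χ : ℝ) :
    |Real.cos χ| = (-1) ^ ⌊χ / Real.pi + 1 / 2⌋ * Real.cos χ := by
  set n := ⌊χ / Real.pi + 1 / 2⌋ with hn
  have hπ := Real.pi_pos
  have h1 : (n : ℝ) ≤ χ / Real.pi + 1 / 2 := Int.floor_le _
  have h2 : χ / Real.pi + 1 / 2 < n + 1 := Int.lt_floor_add_one _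
  have h3 : χ / Real.pi * Real.pi = χ := div_mul_cancel₀ _ hπ.ne'
  have h4 : 0 ≤ Real.cos (χ - n * Real.pi) :=
    Real.cos_nonneg_of_mem_Icc ⟨by nlinarith, by nlinarith⟩
  rw [Real.cos_sub_int_mul_pi] at h4
  rw [← abs_of_nonneg h4, abs_mul, abs_zpow]
  simp

theorem floor_div_pi_add_half_eq {χ : ℝ} {n : ℤ} (h1 : n * Real.pi - Real.pi / 2 ≤ χ)
    (h2 : χ < n * Real.pi + Real.pi / 2) : ⌊χ / Real.pi + 1 / 2⌋ = n := by
  have hπ := Real.pi_pos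
  rw [Int.floor_eq_iff]
  have h3 : χ / Real.pi * Real.pi = χ := div_mul_cancel₀ _ hπ.ne'
  constructor
  · by_contra! h
    nlinarith
  · by_contra! h
    nlinarith

theorem eventually_floor_div_pi_add_half_eq {χ : ℝ} (h : Real.cos χ ≠ 0) :
    ∀ᶠ x in 𝓝 χ, ⌊x / Real.pi + 1 / 2⌋ = ⌊χ / Real.pi + 1 / 2⌋ := by
  have hπ := Real.pi_pos
  set n := ⌊χ / Real.pi + 1 / 2⌋ with hn
  have h1 : (n : ℝ) ≤ χ / Real.pi + 1 / 2 := Int.floor_le _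
  have h2 : χ / Real.pi + 1 / 2 < n + 1 := Int.lt_floor_add_one _
  have h3 : χ / Real.pi * Real.pi = χ := div_mul_cancel₀ _ hπ.ne'
  have h4 : n * Real.pi - Real.pi / 2 ≠ χ := by
    intro h4
    apply h
    rw [Real.cos_eq_zero_iff]
    exact ⟨n - 1, by push_cast; linarith⟩
  have h5 : n * Real.pi - Real.pi / 2 < χ := lt_of_le_of_ne (by nlinarith) h4
  have h6 : χ < n * Real.pi + Real.pi / 2 := by nlinarith
  filter_upwards [Ioo_mem_nhds h5 h6] with x hx
  exact floor_div_pi_add_half_eq hx.1.le hx.2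

/-- A curve whose signed polar radius is a positive multiple of the cosine of the parameter. -/
theorem isTurningAngle_cos {s θ : ℝ → ℝ} (hθ : Continuous θ) :
    IsTurningAngle (fun χ => polarPosition 1 (Real.cos χ) (s χ) (θ χ))
      (fun χ => θ χ + ⌊χ / Real.pi + 1 / 2⌋ * Real.pi) := by
  have hπ := Real.pi_pos
  refine ⟨fun χ => ?_, fun χ h => ?_, fun χ h => ?_⟩
  · rw [polarPosition_radius]
    have h1 : Real.sqrt (1 ^ 2 * Real.cos χ ^ 2) = |Real.cos χ| := by
      rw [one_pow, one_mul, Real.sqrt_sq_eq_abs]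
    have h2 : ((-1 : ℝ) ^ ⌊χ / Real.pi + 1 / 2⌋) * (-1) ^ ⌊χ / Real.pi + 1 / 2⌋ = 1 := by
      rw [← mul_zpow]
      simp
    rw [h1, abs_cos_eq_negOnePow_floor, Real.cos_add_int_mul_pi, Real.sin_add_int_mul_pi]
    simp only [polarPosition, Matrix.cons_val]
    constructor
    · linear_combination -Real.cos χ * Real.cos (θ χ) * h2
    · linear_combination -Real.cos χ * Real.sin (θ χ) * h2
  · have hc : Real.cos χ ≠ 0 := by
      intro hc
      exact h ⟨by simp [polarPosition, hc], by simp [polarPosition, hc]⟩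
    have h1 : ContinuousAt (fun χ => θ χ + (⌊χ / Real.pi + 1 / 2⌋ : ℤ) * Real.pi) χ ↔ _ :=
      continuousAt_congr (g := fun x => θ x + (⌊χ / Real.pi + 1 / 2⌋ : ℤ) * Real.pi) (by
        filter_upwards [eventually_floor_div_pi_add_half_eq hc] with x hx
        rw [hx])
    rw [h1]
    fun_prop
  · have h2 := polarPosition_radius 1 (Real.cos χ) (s χ) (θ χ)
    rw [h.1, h.2] at h2
    have hc : Real.cos χ = 0 := by
      have : Real.cos χ ^ 2 = 0 := by linarith
      exact pow_eq_zero_iff two_ne_zero |>.1 this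
    obtain ⟨n, hn⟩ := Real.cos_eq_zero_iff.1 hc
    have hlim : ∀ m : ℤ, Tendsto (fun x => θ x + m * Real.pi) (𝓝 χ) (𝓝 (θ χ + m * Real.pi)) :=
      fun m => (hθ.add continuous_const).tendsto χ
    -- Here `χ = nπ + π/2`: the floor is `n` just before and `n + 1` just after.
    refine ⟨θ χ + n * Real.pi, ?_, ?_⟩
    · refine ((hlim n).mono_left nhdsWithin_le_nhds).congr' ?_
      filter_upwards [Ioo_mem_nhdsLT (show χ - Real.pi < χ by linarith)] with x hx
      rw [floor_div_pi_add_half_eq (n := n) (by linarith [hx.1]) (by linarith [hx.2])]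
    · have h3 : θ χ + n * Real.pi + Real.pi = θ χ + ((n + 1 : ℤ) : ℝ) * Real.pi := by
        push_cast
        ring
      rw [h3]
      refine ((hlim (n + 1)).mono_left nhdsWithin_le_nhds).congr' ?_
      filter_upwards [Ioo_mem_nhdsGT (show χ < χ + Real.pi by linarith)] with x hx
      rw [floor_div_pi_add_half_eq (n := n + 1) (by push_cast; linarith [hx.1])
        (by push_cast; linarith [hx.2])]

/-- The solution without angular momentum, which runs through the `z`-axis. -/
theorem isReducedSolutionAt_axial (χ : ℝ) :
    IsReducedSolutionAt 0 (fun _ => 1) Real.cos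
      (fun χ => Real.sin χ * Real.sqrt (1 + Real.cos χ ^ 2))
      (fun _ => 1 / Real.sqrt Real.pi) (fun _ => 0)
      (fun χ => Real.arctan (Real.sin χ / Real.sqrt (1 + Real.cos χ ^ 2))) 0
      (2 * Real.sqrt Real.pi / Real.sqrt (1 + Real.cos χ ^ 2)) χ := by
  have hα : 0 < 1 + Real.cos χ ^ 2 := by positivity
  have hα2 := Real.sq_sqrt hα.le
  have hα1 := Real.sqrt_pos.2 hα
  have dα := (((Real.hasDerivAt_cos χ).pow 2).const_add 1).sqrt hα.ne'
  have hγ : 0 < Real.sqrt Real.pi := Real.sqrt_pos.2 Real.pi_pos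
  have hγ2 := Real.sq_sqrt Real.pi_pos.le
  have hp := Real.sin_sq_add_cos_sq χ
  have dS := Real.hasDerivAt_sin χ
  have dC := Real.hasDerivAt_cos χ
  refine ⟨one_pos, by simp, by simp, ?_, ?_, ?_, ?_, ?_, ?_, ?_, ?_⟩
  · rw [mul_pow, hα2]
    linear_combination (1 + Real.cos χ ^ 2) * hp
  · rw [div_pow, hγ2]
    simp
  · refine dC.congr_deriv ?_
    field_simp
  · refine (dS.mul dα).congr_deriv ?_
    field_simp
    simp only [Pi.pow_apply, Nat.cast_ofNat] at *
    grind
  · simpa using hasDerivAt_const χ (1 / Real.sqrt Real.pi)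
  · simpa using hasDerivAt_const χ (0 : ℝ)
  · simpa using hasDerivAt_const χ (1 : ℝ)
  · refine ((dS.div dα hα1.ne').arctan).congr_deriv ?_
    field_simp
    simp only [Pi.div_apply, Pi.pow_apply, Nat.cast_ofNat] at *
    field_simp
    grind

/-- The angle belonging to the signed radius is a periodic arctangent. The cosine changes sign twice
per loop, and these two half turns make up the full turn. -/
theorem exists_orbit_axial : ∃ (q p : ℝ → Fin 3 → ℝ) (T : ℝ), IsOrbit q p ∧
    IsMinimalPeriod q p T ∧ HasRotationNumber q p T 1 1 := by
  have hπ := Real.pi_pos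
  have hθc : Continuous fun χ => Real.arctan (Real.sin χ / Real.sqrt (1 + Real.cos χ ^ 2)) := by
    refine Real.continuous_arctan.comp (Real.continuous_sin.div (by fun_prop) fun χ => ?_)
    positivity
  have hθper : ∀ χ, Real.arctan (Real.sin (χ + 2 * Real.pi) /
      Real.sqrt (1 + Real.cos (χ + 2 * Real.pi) ^ 2))
      = Real.arctan (Real.sin χ / Real.sqrt (1 + Real.cos χ ^ 2)) := fun χ => by
    rw [Real.sin_add_two_pi, Real.cos_add_two_pi]
  have hsqrt : ∀ χ, 0 < Real.sqrt (1 + Real.cos χ ^ 2) := fun χ => by positivity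
  have hdist : ∀ χ, Real.sin χ * Real.sqrt (1 + Real.cos χ ^ 2) =
      Real.sin (Real.pi / 2) * Real.sqrt (1 + Real.cos (Real.pi / 2) ^ 2) →
      ∃ n : ℤ, χ = Real.pi / 2 + n * (2 * Real.pi) := by
    intro χ h
    simp only [Real.sin_pi_div_two, Real.cos_pi_div_two] at h
    norm_num at h
    have hα : 0 ≤ 1 + Real.cos χ ^ 2 := by positivity
    have h1 : Real.sin χ ^ 2 * (1 + Real.cos χ ^ 2) = 1 := by
      rw [← Real.sq_sqrt hα, ← mul_pow, h, one_pow]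
    have hp := Real.sin_sq_add_cos_sq χ
    -- Since `sin² (1 + cos²) = 1 - cos⁴`, the top height is reached only where the cosine vanishes.
    have h2 : Real.cos χ ^ 4 = 0 := by
      rw [← eq_sub_iff_add_eq] at hp
      rw [hp] at h1
      linear_combination -h1
    have h3 : Real.cos χ = 0 := by simpa using h2
    rw [h3] at h
    exact exists_int_of_sin_eq_one (by simpa using h)
  have hΘper : ∀ χ, Real.arctan (Real.sin (χ + 2 * Real.pi) /
        Real.sqrt (1 + Real.cos (χ + 2 * Real.pi) ^ 2))
        + ⌊(χ + 2 * Real.pi) / Real.pi + 1 / 2⌋ * Real.pi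
      = Real.arctan (Real.sin χ / Real.sqrt (1 + Real.cos χ ^ 2))
        + ⌊χ / Real.pi + 1 / 2⌋ * Real.pi + 2 * Real.pi * ((1 : ℕ) / (1 : ℕ)) := by
    intro χ
    have h1 : (χ + 2 * Real.pi) / Real.pi + 1 / 2 = χ / Real.pi + 1 / 2 + (2 : ℤ) := by
      field_simp
      push_cast
      ring
    rw [hθper, h1, Int.floor_add_intCast]
    push_cast
    ring
  obtain ⟨q, p, T, h1, h2, h3, -⟩ :=
    exists_orbit_of_reducedSolution (j := 1) (n := 1) (χ₀ := Real.pi / 2) (χ₁ := 0)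
      (k := fun _ => 0) (u := fun χ => 2 * Real.sqrt Real.pi / Real.sqrt (1 + Real.cos χ ^ 2))
      one_pos (Nat.coprime_one_left 1) isReducedSolutionAt_axial
      (continuous_const.div (by fun_prop) fun χ => (hsqrt χ).ne')
      (fun χ => div_pos (by positivity) (hsqrt χ)) (fun χ => by simp only [Real.cos_add_two_pi])
      (fun χ => rfl) Real.cos_periodic
      (fun χ => by simp only [Real.cos_add_two_pi, Real.sin_add_two_pi]) (fun χ => rfl)
      -- The signed-radius angle does not grow over a loop while the turning angle gains `2π`; `m =
      -- -1` absorbs the difference.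
      (fun χ => rfl) (m := -1)
      (fun χ => by rw [hθper]; push_cast; ring) (by simp) hdist (isTurningAngle_cos hθc) hΘper
  exact ⟨q, p, T, h1, h2, h3⟩

/-! ### The explicit family with nonzero angular momentum -/

/-- The parameters `e = √m` and `f = √(1 - m)`, where `m` is the least value of `r² / ρ²`. -/
structure IsParam (e f : ℝ) : Prop where
  e_pos : 0 < e
  f_pos : 0 < f
  sq_add_sq : e ^ 2 + f ^ 2 = 1

/-- The quotient `e ρ / r`, as a function of the parameter. -/
noncomputable def dnorm (e f χ : ℝ) : ℝ := Real.sqrt (e ^ 2 + f ^ 2 * Real.sin χ ^ 2)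

/-- The quotient `r / ρ` of the distance to the `z`-axis and the homogeneous norm. -/
noncomputable def radius (e f χ : ℝ) : ℝ := e / dnorm e f χ

/-- The square root of `1 + r² / ρ²`. -/
noncomputable def alpha (e f χ : ℝ) : ℝ := Real.sqrt (1 + radius e f χ ^ 2)

/-- The square root of `1 + e² r² / ρ²`. -/
noncomputable def beta (e f χ : ℝ) : ℝ := Real.sqrt (1 + e ^ 2 * radius e f χ ^ 2)

/-- The normalizing constant of the speed. -/
noncomputable def gam (e : ℝ) : ℝ := Real.sqrt (Real.pi * (1 + e ^ 2))

/-- The angular momentum of the solution with parameters `e` and `f`. -/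
noncomputable def angularMomentum (e f : ℝ) : ℝ := e / (2 * f * gam e)

/-- The quotient `4 z / ρ²`. -/
noncomputable def height (e f χ : ℝ) : ℝ := Real.sin χ * f * alpha e f χ / dnorm e f χ

/-- The rate of change of the elevation angle, divided by `r / ρ`. -/
noncomputable def speed (e f χ : ℝ) : ℝ := Real.cos χ * beta e f χ / gam e

/-- The rate of the rescaled time with respect to the parameter. -/
noncomputable def rate (e f χ : ℝ) : ℝ :=
  2 * radius e f χ ^ 2 * f * gam e / (e * alpha e f χ * beta e f χ)

/-- The part of the rate of the polar angle that does not average out over a period. -/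
noncomputable def swing (e f χ : ℝ) : ℝ := (1 - radius e f χ ^ 2) * alpha e f χ / beta e f χ

/-- The square of the reciprocal of the homogeneous norm. -/
noncomputable def invNormSq (e f χ : ℝ) : ℝ :=
  8 * angularMomentum e f ^ 2 * radius e f χ ^ 2 + 1 / Real.pi
    + 4 * angularMomentum e f * radius e f χ * speed e f χ

/-- The polar angle of the solution. -/
noncomputable def polarAngle (e f χ : ℝ) : ℝ :=
  Real.arctan (Real.sin χ * f / (dnorm e f χ * alpha e f χ)) + ∫ x in (0 : ℝ)..χ, swing e f x

variable {e f : ℝ}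

theorem IsParam.dnorm_pos (H : IsParam e f) (χ : ℝ) : 0 < dnorm e f χ := by
  have := H.e_pos
  unfold dnorm
  positivity

theorem dnorm_sq (e f χ : ℝ) :
    dnorm e f χ ^ 2 = e ^ 2 + f ^ 2 * Real.sin χ ^ 2 := Real.sq_sqrt (by positivity)

theorem IsParam.radius_pos (H : IsParam e f) (χ : ℝ) : 0 < radius e f χ :=
  div_pos H.e_pos (H.dnorm_pos χ)

theorem alpha_pos (e f χ : ℝ) : 0 < alpha e f χ := Real.sqrt_pos.2 (by positivity)

theorem beta_pos (e f χ : ℝ) : 0 < beta e f χ := Real.sqrt_pos.2 (by positivity)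

theorem alpha_sq (e f χ : ℝ) : alpha e f χ ^ 2 = 1 + radius e f χ ^ 2 :=
  Real.sq_sqrt (by positivity)

theorem beta_sq (e f χ : ℝ) : beta e f χ ^ 2 = 1 + e ^ 2 * radius e f χ ^ 2 :=
  Real.sq_sqrt (by positivity)

theorem gam_pos (e : ℝ) : 0 < gam e :=
  Real.sqrt_pos.2 (mul_pos Real.pi_pos (by positivity))

theorem gam_sq (e : ℝ) : gam e ^ 2 = Real.pi * (1 + e ^ 2) :=
  Real.sq_sqrt (mul_nonneg Real.pi_pos.le (by positivity))

theorem IsParam.hasDerivAt_dnorm (H : IsParam e f) (χ : ℝ) :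
    HasDerivAt (dnorm e f) (f ^ 2 * Real.sin χ * Real.cos χ / dnorm e f χ) χ := by
  have h0 : 0 < e ^ 2 + f ^ 2 * Real.sin χ ^ 2 := by
    have := H.e_pos
    positivity
  refine (((((Real.hasDerivAt_sin χ).pow 2).const_mul (f ^ 2)).const_add (e ^ 2)).sqrt
    h0.ne').congr_deriv ?_
  simp only [Pi.pow_apply, Nat.cast_ofNat, dnorm]
  have := Real.sqrt_pos.2 h0
  field_simp
  ring

theorem IsParam.hasDerivAt_radius (H : IsParam e f) (χ : ℝ) :
    HasDerivAt (radius e f) (-(e * f ^ 2 * Real.sin χ * Real.cos χ / dnorm e f χ ^ 3)) χ := by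
  have h := H.dnorm_pos χ
  refine ((hasDerivAt_const χ e).div (H.hasDerivAt_dnorm χ) h.ne').congr_deriv ?_
  field_simp
  ring

theorem IsParam.hasDerivAt_alpha (H : IsParam e f) (χ : ℝ) :
    HasDerivAt (alpha e f)
      (-(e ^ 2 * f ^ 2 * Real.sin χ * Real.cos χ / (dnorm e f χ ^ 4 * alpha e f χ))) χ := by
  have h := H.dnorm_pos χ
  have ha := alpha_pos e f χ
  refine ((((H.hasDerivAt_radius χ).pow 2).const_add 1).sqrt
    (by simp only [Pi.pow_apply]; positivity)).congr_deriv ?_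
  change _ / (2 * alpha e f χ) = _
  simp only [radius, Nat.cast_ofNat]
  field_simp
  norm_num
  field_simp
  simp

theorem IsParam.hasDerivAt_beta (H : IsParam e f) (χ : ℝ) :
    HasDerivAt (beta e f)
      (-(e ^ 4 * f ^ 2 * Real.sin χ * Real.cos χ / (dnorm e f χ ^ 4 * beta e f χ))) χ := by
  have h := H.dnorm_pos χ
  have ha := beta_pos e f χ
  refine (((((H.hasDerivAt_radius χ).pow 2).const_mul (e ^ 2)).const_add 1).sqrt
    (by simp only [Pi.pow_apply]; positivity)).congr_deriv ?_
  change _ / (2 * beta e f χ) = _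
  simp only [radius, Nat.cast_ofNat]
  field_simp
  norm_num
  field_simp
  simp

/-- From `f² sin² / Δ² = 1 - R²`, with `Δ` for `dnorm`, the squared height is `(1 - R²)(1 + R²)`. -/
theorem IsParam.radius_pow_four_add_height_sq (H : IsParam e f) (χ : ℝ) :
    radius e f χ ^ 4 + height e f χ ^ 2 = 1 := by
  have h := H.dnorm_pos χ
  have h2 := dnorm_sq e f χ
  have a2 := alpha_sq e f χ
  have h3 := H.sq_add_sq
  have hp := Real.sin_sq_add_cos_sq χ
  simp only [height, div_pow, mul_pow, a2]
  simp only [radius]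
  field_simp
  grind

/-- This identity dictates the constants: with `f²(1 + e²) = 1 - e⁴`, the right side is a multiple
of `(R² - e²)(1 + e²R²) / R²`. The first factor is `f² cos² R²`, the second is `beta` squared. -/
theorem IsParam.speed_sq (H : IsParam e f) (χ : ℝ) :
    speed e f χ ^ 2 = 1 / Real.pi
      - 4 * (angularMomentum e f / radius e f χ) ^ 2 * height e f χ ^ 2 := by
  have h := H.dnorm_pos χ
  have h2 := dnorm_sq e f χ
  have a2 := alpha_sq e f χ
  have b2 := beta_sq e f χ
  have g2 := gam_sq e
  have g1 := gam_pos e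
  have h3 := H.sq_add_sq
  have hp := Real.sin_sq_add_cos_sq χ
  have he := H.e_pos
  have hf := H.f_pos
  have hπ := Real.pi_pos
  simp only [speed, angularMomentum, height, div_pow, mul_pow, a2, b2, g2]
  simp only [radius]
  field_simp
  grind

theorem IsParam.hasDerivAt_radius' (H : IsParam e f) (χ : ℝ) :
    HasDerivAt (radius e f) (rate e f χ * (-height e f χ * speed e f χ / 2)) χ := by
  refine (H.hasDerivAt_radius χ).congr_deriv ?_
  have h := H.dnorm_pos χ
  have g1 := gam_pos e
  have he := H.e_pos
  have ha := alpha_pos e f χ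
  have hb := beta_pos e f χ
  simp only [rate, height, speed, radius]
  field_simp

theorem IsParam.hasDerivAt_height (H : IsParam e f) (χ : ℝ) :
    HasDerivAt (height e f) (rate e f χ * (radius e f χ ^ 3 * speed e f χ)) χ := by
  have h := H.dnorm_pos χ
  refine ((((Real.hasDerivAt_sin χ).mul_const f).mul (H.hasDerivAt_alpha χ)).div
    (H.hasDerivAt_dnorm χ) h.ne').congr_deriv ?_
  have h2 := dnorm_sq e f χ
  have a2 := alpha_sq e f χ
  have g1 := gam_pos e
  have h3 := H.sq_add_sq
  have hp := Real.sin_sq_add_cos_sq χ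
  have he := H.e_pos
  have ha := alpha_pos e f χ
  have hb := beta_pos e f χ
  simp only [rate, speed, radius, Pi.mul_apply] at *
  field_simp at *
  generalize dnorm e f χ = Δ, alpha e f χ = α, Real.sin χ = S, Real.cos χ = C at *
  grind

theorem IsParam.hasDerivAt_speed (H : IsParam e f) (χ : ℝ) :
    HasDerivAt (speed e f) (rate e f χ * (-2 * (angularMomentum e f / radius e f χ ^ 2) ^ 2
      * radius e f χ * height e f χ * (1 + radius e f χ ^ 4))) χ := by
  have h := H.dnorm_pos χ
  refine (((Real.hasDerivAt_cos χ).mul (H.hasDerivAt_beta χ)).div_const (gam e)).congr_deriv ?_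
  have h2 := dnorm_sq e f χ
  have b2 := beta_sq e f χ
  have g1 := gam_pos e
  have h3 := H.sq_add_sq
  have hp := Real.sin_sq_add_cos_sq χ
  have he := H.e_pos
  have hf := H.f_pos
  have ha := alpha_pos e f χ
  have hb := beta_pos e f χ
  simp only [rate, height, angularMomentum, radius] at *
  field_simp at *
  generalize dnorm e f χ = Δ, beta e f χ = β, Real.sin χ = S, Real.cos χ = C at *
  grind

theorem IsParam.continuous_radius (H : IsParam e f) : Continuous (radius e f) :=
  continuous_iff_continuousAt.2 fun χ => (H.hasDerivAt_radius χ).continuousAt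

theorem IsParam.continuous_alpha (H : IsParam e f) : Continuous (alpha e f) :=
  continuous_iff_continuousAt.2 fun χ => (H.hasDerivAt_alpha χ).continuousAt

theorem IsParam.continuous_beta (H : IsParam e f) : Continuous (beta e f) :=
  continuous_iff_continuousAt.2 fun χ => (H.hasDerivAt_beta χ).continuousAt

theorem IsParam.continuous_swing (H : IsParam e f) : Continuous (swing e f) :=
  ((continuous_const.sub (H.continuous_radius.pow 2)).mul H.continuous_alpha).div
    H.continuous_beta fun χ => (beta_pos e f χ).ne'

theorem IsParam.continuous_rate (H : IsParam e f) : Continuous (rate e f) :=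
  ((((continuous_const.mul (H.continuous_radius.pow 2)).mul_const f).mul_const (gam e)).div
    ((H.continuous_alpha.const_mul e).mul H.continuous_beta) fun χ =>
      (mul_pos (mul_pos H.e_pos (alpha_pos e f χ)) (beta_pos e f χ)).ne')

theorem IsParam.rate_pos (H : IsParam e f) (χ : ℝ) : 0 < rate e f χ := by
  have := H.e_pos
  have := H.f_pos
  have := H.radius_pos χ
  have := gam_pos e
  have := alpha_pos e f χ
  have := beta_pos e f χ
  unfold rate
  positivity

/-- The arctangent is a periodic part split off from the angle; `swing` is what remains of its rate.
-/
theorem IsParam.hasDerivAt_polarAngle (H : IsParam e f) (χ : ℝ) :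
    HasDerivAt (polarAngle e f) (rate e f χ * (radius e f χ * speed e f χ / 2
      + angularMomentum e f / radius e f χ ^ 2 * height e f χ ^ 2)) χ := by
  have h := H.dnorm_pos χ
  have ha := alpha_pos e f χ
  have hint : HasDerivAt (fun χ => ∫ x in (0 : ℝ)..χ, swing e f x) (swing e f χ) χ :=
    intervalIntegral.integral_hasDerivAt_right (H.continuous_swing.intervalIntegrable 0 χ)
      (H.continuous_swing.stronglyMeasurableAtFilter _ _) H.continuous_swing.continuousAt
  refine ((((Real.hasDerivAt_sin χ).mul_const f).div
    ((H.hasDerivAt_dnorm χ).mul (H.hasDerivAt_alpha χ)) (mul_pos h ha).ne').arctan.add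
    hint).congr_deriv ?_
  have h2 := dnorm_sq e f χ
  have a2 := alpha_sq e f χ
  have g1 := gam_pos e
  have h3 := H.sq_add_sq
  have hp := Real.sin_sq_add_cos_sq χ
  have he := H.e_pos
  have hf := H.f_pos
  have hb := beta_pos e f χ
  simp only [Pi.div_apply, Pi.mul_apply]
  have hda : (dnorm e f χ * alpha e f χ) ^ 2 = dnorm e f χ ^ 2 + e ^ 2 := by
    rw [mul_pow, a2, radius]
    field_simp
  have hS : 1 + (Real.sin χ * f / (dnorm e f χ * alpha e f χ)) ^ 2
      = 2 * dnorm e f χ ^ 2 / (dnorm e f χ * alpha e f χ) ^ 2 := by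
    rw [div_pow, hda]
    field_simp
    linear_combination -h2
  rw [hS]
  simp only [rate, height, speed, swing, angularMomentum, radius] at *
  field_simp at *
  generalize dnorm e f χ = Δ, alpha e f χ = α, beta e f χ = β, Real.sin χ = S, Real.cos χ = C at *
  grind

/-- The cross term is dominated: `(8L²R² + 1/π)² - (4LRh)²` collapses to `64L⁴ + 1/π²` by the energy
relation and `R⁴ + s² = 1`. -/
theorem IsParam.invNormSq_pos (H : IsParam e f) (χ : ℝ) : 0 < invNormSq e f χ := by
  have hR := H.radius_pos χ
  have h1 := H.speed_sq χ
  have h2 := H.radius_pow_four_add_height_sq χ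
  have hπ := Real.pi_pos
  unfold invNormSq
  generalize radius e f χ = R, speed e f χ = h, height e f χ = s, angularMomentum e f = L at *
  have h3 : (4 * L * R * h) ^ 2 < (8 * L ^ 2 * R ^ 2 + 1 / Real.pi) ^ 2 := by
    rw [← sub_pos]
    have h4 : (8 * L ^ 2 * R ^ 2 + 1 / Real.pi) ^ 2 - (4 * L * R * h) ^ 2
        = 64 * L ^ 4 + (1 / Real.pi) ^ 2 := by
      rw [mul_pow _ h, h1]
      rw [← eq_sub_iff_add_eq'] at h2
      rw [h2]
      field_simp
      ring
    rw [h4]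
    positivity
  have h5 := (abs_lt_of_sq_lt_sq' h3 (by positivity)).1
  linarith

/-- This closed form solves the linear equation for `ρ⁻²`, so `ρ` inherits periodicity from `R` and
`h` without an integral to evaluate. -/
theorem IsParam.hasDerivAt_invNormSq (H : IsParam e f) (χ : ℝ) :
    HasDerivAt (invNormSq e f)
      (rate e f χ * (-2 * angularMomentum e f * height e f χ * invNormSq e f χ)) χ := by
  refine (((((H.hasDerivAt_radius' χ).pow 2).const_mul (8 * angularMomentum e f ^ 2)).add_const
    (1 / Real.pi)).add (((H.hasDerivAt_radius' χ).const_mul (4 * angularMomentum e f)).mul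
    (H.hasDerivAt_speed χ))).congr_deriv ?_
  have hR := H.radius_pos χ
  have h1 := H.speed_sq χ
  have h2 := H.radius_pow_four_add_height_sq χ
  have hπ := Real.pi_pos
  simp only [Nat.cast_ofNat]
  unfold invNormSq
  generalize radius e f χ = R, speed e f χ = h, height e f χ = s, angularMomentum e f = L,
    rate e f χ = u at *
  field_simp at *
  grind

theorem IsParam.isReducedSolutionAt (H : IsParam e f) (χ : ℝ) :
    IsReducedSolutionAt (angularMomentum e f) (fun χ => 1 / Real.sqrt (invNormSq e f χ))
      (radius e f) (height e f) (speed e f) (fun χ => angularMomentum e f / radius e f χ)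
      (polarAngle e f) (angularMomentum e f / radius e f χ ^ 2) (rate e f χ) χ := by
  have hR := H.radius_pos χ
  have hM := H.invNormSq_pos χ
  have hsM := Real.sqrt_pos.2 hM
  have hM2 := Real.sq_sqrt hM.le
  refine ⟨by positivity, by field_simp, by field_simp, H.radius_pow_four_add_height_sq χ,
    H.speed_sq χ, H.hasDerivAt_radius' χ, H.hasDerivAt_height χ, H.hasDerivAt_speed χ, ?_, ?_,
    H.hasDerivAt_polarAngle χ⟩
  · refine ((hasDerivAt_const χ _).div (H.hasDerivAt_radius' χ) hR.ne').congr_deriv ?_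
    field_simp
    ring
  · refine ((hasDerivAt_const χ _).div ((H.hasDerivAt_invNormSq χ).sqrt hM.ne')
      hsM.ne').congr_deriv ?_
    field_simp
    rw [hM2]
    ring

/-! ### Growth of the polar angle over a loop -/

theorem radius_sq_le_one (e f χ : ℝ) : radius e f χ ^ 2 ≤ 1 := by
  rw [radius, div_pow, dnorm, Real.sq_sqrt (by positivity)]
  exact div_le_one_of_le₀ (by nlinarith [sq_nonneg (f * Real.sin χ)]) (by positivity)

theorem abs_swing_le (e f χ : ℝ) : |swing e f χ| ≤ 2 := by
  have h1 := radius_sq_le_one e f χ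
  have h2 := sq_nonneg (radius e f χ)
  have ha : alpha e f χ ≤ 2 := Real.sqrt_le_iff.2 ⟨by norm_num, by linarith⟩
  have ha0 := alpha_pos e f χ
  have hb : 1 ≤ beta e f χ := Real.one_le_sqrt.2 (by nlinarith [mul_nonneg (sq_nonneg e) h2])
  rw [swing, abs_div, abs_mul, abs_of_pos ha0, abs_of_pos (beta_pos e f χ),
    abs_of_nonneg (by linarith : 0 ≤ 1 - radius e f χ ^ 2), div_le_iff₀ (beta_pos e f χ)]
  nlinarith

theorem measurable_swing (e f : ℝ) : Measurable (swing e f) := by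
  unfold swing alpha beta radius dnorm
  fun_prop

theorem ae_sin_ne_zero : ∀ᵐ χ : ℝ, Real.sin χ ≠ 0 := by
  have h : {χ : ℝ | ¬ Real.sin χ ≠ 0} = Set.range fun n : ℤ => (n : ℝ) * Real.pi := by
    ext χ
    simp [Real.sin_eq_zero_iff]
  rw [MeasureTheory.ae_iff, h]
  exact (Set.countable_range _).measure_zero _

/-- The only degeneration is at `e₀ = 0`, where `dnorm` becomes `|sin χ|`; the excluded zeros of the
sine form a null set. -/
theorem continuousAt_swing_param {e₀ χ : ℝ} (he : e₀ ∈ Set.Icc (0 : ℝ) 1) (hχ : Real.sin χ ≠ 0) :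
    ContinuousAt (fun e => swing e (Real.sqrt (1 - e ^ 2)) χ) e₀ := by
  have hd : ContinuousAt (fun e => dnorm e (Real.sqrt (1 - e ^ 2)) χ) e₀ := by
    unfold dnorm
    fun_prop
  have hd0 : dnorm e₀ (Real.sqrt (1 - e₀ ^ 2)) χ ≠ 0 := by
    have h0 : 0 ≤ 1 - e₀ ^ 2 := by nlinarith [he.1, he.2]
    apply (Real.sqrt_pos.2 _).ne'
    rw [Real.sq_sqrt h0]
    rcases eq_or_ne e₀ 0 with rfl | h
    · simp only [ne_eq, OfNat.ofNat_ne_zero, not_false_eq_true, zero_pow, sub_zero, one_mul,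
        zero_add]
      positivity
    · have := mul_nonneg h0 (sq_nonneg (Real.sin χ))
      positivity
  have hr : ContinuousAt (fun e => radius e (Real.sqrt (1 - e ^ 2)) χ) e₀ :=
    continuousAt_id.div hd hd0
  have ha : ContinuousAt (fun e => alpha e (Real.sqrt (1 - e ^ 2)) χ) e₀ :=
    (continuousAt_const.add (hr.pow 2)).sqrt
  have hb : ContinuousAt (fun e => beta e (Real.sqrt (1 - e ^ 2)) χ) e₀ :=
    (continuousAt_const.add ((continuousAt_id.pow 2).mul (hr.pow 2))).sqrt
  exact ((continuousAt_const.sub (hr.pow 2)).mul ha).div hb (beta_pos _ _ _).ne'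

/-- Every angle strictly between zero and a whole turn is the growth of the polar angle over a
period for some parameter. -/
theorem exists_param_integral_swing_eq {a : ℝ} (h0 : 0 < a) (h1 : a < 2 * Real.pi) :
    ∃ e f : ℝ, IsParam e f ∧ ∫ χ in (0 : ℝ)..(2 * Real.pi), swing e f χ = a := by
  set F : ℝ → ℝ := fun e => ∫ χ in (0 : ℝ)..(2 * Real.pi), swing e (Real.sqrt (1 - e ^ 2)) χ with hF
  -- At `e = 0` the radius is identically zero and `swing` is constantly `1`; at `e = 1` the radius
  -- is `1` and `swing` vanishes.
  have hF0 : F 0 = 2 * Real.pi := by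
    simp [hF, swing, radius, alpha, beta]
  have hF1 : F 1 = 0 := by
    simp [hF, swing, radius, dnorm]
  have hc : ContinuousOn F (Set.Icc 0 1) := by
    intro e₀ he₀
    refine ContinuousAt.continuousWithinAt ?_
    refine intervalIntegral.continuousAt_of_dominated_interval (bound := fun _ => 2)
      (Eventually.of_forall fun e => (measurable_swing _ _).aestronglyMeasurable)
      (Eventually.of_forall fun e => MeasureTheory.ae_of_all _ fun χ _ => abs_swing_le _ _ χ)
      intervalIntegrable_const ?_
    filter_upwards [ae_sin_ne_zero] with χ hχ _
    exact continuousAt_swing_param he₀ hχ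
  obtain ⟨e, he, hea⟩ := intermediate_value_Icc' zero_le_one hc
    (show a ∈ Set.Icc (F 1) (F 0) from ⟨by rw [hF1]; exact h0.le, by rw [hF0]; exact h1.le⟩)
  have he0 : 0 < e := lt_of_le_of_ne he.1 fun h => by
    rw [← h, hF0] at hea
    exact h1.ne' hea
  have he1 : e < 1 := lt_of_le_of_ne he.2 fun h => by
    rw [h, hF1] at hea
    exact h0.ne hea
  have hf : 0 < 1 - e ^ 2 := by nlinarith
  exact ⟨e, Real.sqrt (1 - e ^ 2), ⟨he0, Real.sqrt_pos.2 hf, by rw [Real.sq_sqrt hf.le]; ring⟩, hea⟩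

/-! ### Periodicity and the orbits off the axis -/

theorem dnorm_periodic (e f : ℝ) : Function.Periodic (dnorm e f) (2 * Real.pi) := fun χ => by
  simp only [dnorm, Real.sin_add_two_pi]

theorem radius_periodic (e f : ℝ) : Function.Periodic (radius e f) (2 * Real.pi) := fun χ => by
  simp only [radius, dnorm_periodic e f χ]

theorem alpha_periodic (e f : ℝ) : Function.Periodic (alpha e f) (2 * Real.pi) := fun χ => by
  simp only [alpha, radius_periodic e f χ]

theorem beta_periodic (e f : ℝ) : Function.Periodic (beta e f) (2 * Real.pi) := fun χ => by
  simp only [beta, radius_periodic e f χ]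

theorem height_periodic (e f : ℝ) : Function.Periodic (height e f) (2 * Real.pi) := fun χ => by
  simp only [height, Real.sin_add_two_pi, alpha_periodic e f χ, dnorm_periodic e f χ]

theorem speed_periodic (e f : ℝ) : Function.Periodic (speed e f) (2 * Real.pi) := fun χ => by
  simp only [speed, Real.cos_add_two_pi, beta_periodic e f χ]

theorem rate_periodic (e f : ℝ) : Function.Periodic (rate e f) (2 * Real.pi) := fun χ => by
  simp only [rate, radius_periodic e f χ, alpha_periodic e f χ, beta_periodic e f χ]

theorem swing_periodic (e f : ℝ) : Function.Periodic (swing e f) (2 * Real.pi) := fun χ => by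
  simp only [swing, radius_periodic e f χ, alpha_periodic e f χ, beta_periodic e f χ]

theorem invNormSq_periodic (e f : ℝ) : Function.Periodic (invNormSq e f) (2 * Real.pi) :=
  fun χ => by simp only [invNormSq, radius_periodic e f χ, speed_periodic e f χ]

theorem IsParam.polarAngle_add_two_pi (H : IsParam e f) (χ : ℝ) :
    polarAngle e f (χ + 2 * Real.pi)
      = polarAngle e f χ + ∫ x in (0 : ℝ)..(2 * Real.pi), swing e f x := by
  have hint : ∀ a b, IntervalIntegrable (swing e f) MeasureTheory.volume a b := fun a b =>
    H.continuous_swing.intervalIntegrable a b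
  have h1 := (swing_periodic e f).intervalIntegral_add_eq χ 0
  rw [zero_add] at h1
  simp only [polarAngle, Real.sin_add_two_pi, alpha_periodic e f χ, dnorm_periodic e f χ]
  rw [← h1, add_assoc,
    intervalIntegral.integral_add_adjacent_intervals (hint _ _) (hint _ _)]

/-- Equal heights force equal radii, hence `dnorm = 1` and `sin² = 1`; the positive height selects
`sin = 1`. -/
theorem IsParam.exists_int_of_height_eq (H : IsParam e f) {χ : ℝ}
    (h : height e f χ = height e f (Real.pi / 2)) :
    ∃ n : ℤ, χ = Real.pi / 2 + n * (2 * Real.pi) := by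
  have he := H.e_pos
  have hf := H.f_pos
  have hd : dnorm e f (Real.pi / 2) = 1 := by simp [dnorm, H.sq_add_sq]
  have hpos : 0 < height e f (Real.pi / 2) := by
    have := alpha_pos e f (Real.pi / 2)
    rw [height, hd, Real.sin_pi_div_two]
    positivity
  have h1 := H.radius_pow_four_add_height_sq χ
  rw [h, ← H.radius_pow_four_add_height_sq (Real.pi / 2), add_left_inj,
    pow_left_inj₀ (H.radius_pos _).le (H.radius_pos _).le (by norm_num), radius, radius, hd,
    div_one, div_eq_iff (H.dnorm_pos χ).ne'] at h1
  have h2 : dnorm e f χ = 1 := mul_left_cancel₀ he.ne' (by linarith)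
  have h3 := dnorm_sq e f χ
  rw [h2] at h3
  have h4 : f ^ 2 * (Real.sin χ ^ 2 - 1) = 0 := by linear_combination -h3 - H.sq_add_sq
  have h5 : Real.sin χ ^ 2 - 1 = 0 := (mul_eq_zero.1 h4).resolve_left (by positivity)
  have h6 : 0 < Real.sin χ := by
    rw [← h, height, h2, div_one, mul_assoc] at hpos
    exact pos_of_mul_pos_left hpos (mul_pos hf (alpha_pos e f χ)).le
  exact exists_int_of_sin_eq_one (by nlinarith)

theorem isTurningAngle_of_pos {ρ R s θ : ℝ → ℝ} (hρ : ∀ χ, 0 < ρ χ) (hR : ∀ χ, 0 < R χ)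
    (hθ : Continuous θ) :
    IsTurningAngle (fun χ => polarPosition (ρ χ) (R χ) (s χ) (θ χ)) θ := by
  refine ⟨fun χ => ?_, fun χ _ => hθ.continuousAt, fun χ h => ?_⟩
  · rw [polarPosition_radius, ← mul_pow, Real.sqrt_sq (mul_pos (hρ χ) (hR χ)).le]
    exact ⟨rfl, rfl⟩
  · exact absurd h (not_onAxis_polarPosition (hρ χ).ne' (hR χ).ne')

theorem exists_orbit_off_axis {j k : ℕ} (hj : 0 < j) (hjk : j < k) (hcop : Nat.Coprime j k) :
    ∃ (q p : ℝ → Fin 3 → ℝ) (T : ℝ), IsOrbit q p ∧ IsMinimalPeriod q p T ∧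
      HasRotationNumber q p T j k ∧ ∀ t, ¬ OnAxis (q t) := by
  have hπ := Real.pi_pos
  have hj' : (0 : ℝ) < j := by exact_mod_cast hj
  have hk : 0 < k := hj.trans hjk
  have hk' : (0 : ℝ) < k := by exact_mod_cast hk
  have hjk' : (j : ℝ) / k < 1 := (div_lt_one hk').2 (by exact_mod_cast hjk)
  obtain ⟨e, f, H, hef⟩ := exists_param_integral_swing_eq
    (a := 2 * Real.pi * (j / k)) (by positivity) (by nlinarith)
  have hper : ∀ χ, polarAngle e f (χ + 2 * Real.pi) = polarAngle e f χ + 2 * Real.pi * (j / k) :=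
    fun χ => by rw [H.polarAngle_add_two_pi, hef]
  have hρ : ∀ χ, 0 < 1 / Real.sqrt (invNormSq e f χ) := fun χ => (H.isReducedSolutionAt χ).ρ_pos
  obtain ⟨q, p, T, h1, h2, h3, h4⟩ := exists_orbit_of_reducedSolution (m := 0) (χ₁ := 0) hk hcop
    H.isReducedSolutionAt H.continuous_rate H.rate_pos (rate_periodic e f)
    (fun χ => by simp only [invNormSq_periodic e f χ]) (radius_periodic e f)
    (height_periodic e f) (speed_periodic e f) (fun χ => by simp only [radius_periodic e f χ])
    (fun χ => by rw [hper]; simp) (H.radius_pos _).ne' (fun χ => H.exists_int_of_height_eq)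
    (isTurningAngle_of_pos hρ H.radius_pos (continuous_iff_continuousAt.2 fun χ =>
      (H.hasDerivAt_polarAngle χ).continuousAt)) hper
  refine ⟨q, p, T, h1, h2, h3, fun t => ?_⟩
  obtain ⟨χ, hχ⟩ := h4 t
  rw [hχ]
  exact not_onAxis_polarPosition (hρ χ).ne' (H.radius_pos χ).ne'

end KeplerHeisenberg

theorem mainTheorem3 (j k : ℕ) (hj : 0 < j) (hjk : j ≤ k) (hcop : Nat.Coprime j k) :
    ∃ (q p : ℝ → Fin 3 → ℝ) (T : ℝ),
      KeplerHeisenberg.IsOrbit q p ∧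
      KeplerHeisenberg.IsMinimalPeriod q p T ∧
      KeplerHeisenberg.HasRotationNumber q p T j k ∧
      (j < k → ∀ t, ¬ KeplerHeisenberg.OnAxis (q t)) := by
  rcases hjk.lt_or_eq with h | rfl
  · obtain ⟨q, p, T, h1, h2, h3, h4⟩ := KeplerHeisenberg.exists_orbit_off_axis hj h hcop
    exact ⟨q, p, T, h1, h2, h3, fun _ => h4⟩
  · obtain rfl : j = 1 := (Nat.coprime_self j).1 hcop
    obtain ⟨q, p, T, h1, h2, h3⟩ := KeplerHeisenberg.exists_orbit_axial
    exact ⟨q, p, T, h1, h2, h3, fun h => absurd h (lt_irrefl 1)⟩
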